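/- Let $\mathbb K$ be a field, $d\ge 0$ an integer and $V$ a $\mathbb K$-vector space of dimension $d+1$. A linear map $V\to V$ is *multiplicity-free* if $V$ is spanned by its eigenspaces and each eigenspace has dimension one; its *primitive idempotents* are the projections that are the identity on one eigenspace and zero on all the others. A *thin Hessenberg (TH) system* on $V$ is a sequence $\Phi=(A;\{E_i\}_{i=0}^d;A^*;\{E_i^*\}_{i=0}^d)$ where $A,A^*$ are multiplicity-free elements of $\mathrm{End}(V)$, $\{E_i\}$ (resp. $\{E_i^*\}$) is an ordering of the primitive idempotents of $A$ (resp. $A^*$), and, for $0\le i,j\le d$, each of $E_iA^*E_j$ and $E_i^*AE_j^*$ is zero if $i-j>1$ and nonzero if $i-j=1$. Let $\theta_i$ (resp. $\theta_i^*$) be the eigenvalue of $A$ (resp. $A^*$) corresponding to $E_i$ (resp. $E_i^*$). *Relatives.* Let $\Phi^*=(A^*;\{E_i^*\};A;\{E_i\})$ and $\tilde\Phi=(A^\sigma;\{E_{d-i}^\sigma\};A^{*\sigma};\{E_{d-i}^{*\sigma}\})$, where $\sigma$ sends $S\in\mathrm{End}(V)$ to its transpose $f\mapsto f\circ S$ on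 the dual space $\tilde V$ of $V$. These are TH systems, and $\tilde\Phi^*$ is the TH system $(\tilde\Phi)^*$. For an object $f$ attached to $\Phi$, write $f^*,\tilde f,\tilde f^*$ for the corresponding object attached to $\Phi^*,\tilde\Phi,\tilde\Phi^*$. *Scalars.* Put $$\ell_i=\frac{\prod_{h=1}^{d}(\theta_0^*-\theta_h^*)}{\prod_{0\le h\le d,\,h\ne i}(\theta_i^*-\theta_h^*)}\quad(0\le i\le d),\qquad \nu=\frac{1}{\mathrm{trace}(E_0E_0^*)} .$$ *Matrices.* For $0\ne\xi_0\in E_0V$ the sequence $\{E_j^*\xi_0\}_{j=0}^d$ is a basis of $V$, called $\Phi$-standard. Put $\xi_0^*=E_0^*\xi_0$; then $\{E_i\xi_0^*\}_{i=0}^d$ is a $\Phi^*$-standard basis. Let $P$ be the $(d+1)\times(d+1)$ matrix, indexed by $0,\dots,d$, with $E_j^*\xi_0=\sum_{i=0}^dP_{ij}E_i\xi_0^*$ for $0\le j\le d$; it does not depend on $\xi_0$. For $0\le i\le d$ put $U_i=(E_0^*V+\cdots+E_i^*V)\cap(E_0V+\cdots+E_{d-i}V)$, and for $1\le i\le d$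 let $\varphi_i$ be the eigenvalue of $(A-\theta_{d-i+1}I)(A^*-\theta_i^*I)$ on the one-dimensional space $U_i$; the scalars $\varphi_i$ are nonzero. Let $\mathcal P$ be the $(d+1)\times(d+1)$ matrix with entries $\mathcal P_{ij}=p(\theta_i,\theta_j^*)$, where $$p(\lambda,\mu)=\sum_{h=0}^d\frac{\prod_{k=0}^{h-1}(\lambda-\theta_{d-k})\,\prod_{k=0}^{h-1}(\mu-\theta_k^*)}{\varphi_1\varphi_2\cdots\varphi_h}.$$ *Polynomials.* Let $H$ be the matrix representing $A$ with respect to a $\Phi$-standard basis (so $A v_j=\sum_i H_{ij}v_i$ for that basis $\{v_i\}$); it does not depend on the choice of the basis. Let $s_0=1$, let $s_1,\dots,s_d\in\mathbb K[\lambda]$ be given by $\lambda s_j=\sum_{i=0}^{j+1}H_{ij}s_i$ for $0\le j\le d-1$, and put $t_i=s_i/\ell_i$ for $0\le i\le d$. Then the following hold. 1. For $0\le i,j\le d$, $$P_{ij}=\ell_j\,t_j(\theta_i)=\ell_j\,\tilde t^*_{d-i}(\theta^*_j)=s_j(\theta_i)=\ell_j\,\tilde s^*_{d-i}(\theta^*_j)/\tilde\ell^*_{d-i}.$$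 2. For $0\le i,j\le d$, $$\mathcal P_{ij}=t_j(\theta_i)=\tilde t^*_{d-i}(\theta^*_j)=s_j(\theta_i)/\ell_j=\tilde s^*_{d-i}(\theta^*_j)/\tilde\ell^*_{d-i}.$$ 3. For $0\le i,j\le d$, $$\sum_{n=0}^d t_i(\theta_n)\,\tilde t_j(\theta_n)\,\ell_n^*=\delta_{i+j,d}\,\nu\,\ell_i^{-1}.$$ 4. For $0\le m,n\le d$, $$\sum_{i=0}^d t_i(\theta_m)\,\tilde t_{d-i}(\theta_n)\,\ell_i=\delta_{mn}\,\nu\,(\ell_m^*)^{-1}.$$ -/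

import Mathlib

open Polynomial

noncomputable section

/-! ### Multiplicity-free maps and primitive idempotents -/

/-- `A` is diagonalizable (its eigenspaces span `V`) and each eigenspace has dimension one. -/
structure IsMultiplicityFree {K V : Type*} [Field K] [AddCommGroup V] [Module K V]
    (A : Module.End K V) : Prop where
  span_eigenspaces : ⨆ μ : K, Module.End.eigenspace A μ = ⊤
  finrank_eigenspace : ∀ μ : K, A.HasEigenvalue μ →
    Module.finrank K (Module.End.eigenspace A μ) = 1

/-- `θ` is an ordering of the eigenvalues of `A`, and `E i` is the primitive idempotent of `A` for
`θ i`: it is the identity on the eigenspace of `θ i` and zero on the other eigenspaces. -/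
structure IsPrimitiveIdempotents {K V : Type*} [Field K] [AddCommGroup V] [Module K V] {d : ℕ}
    (A : Module.End K V) (θ : Fin (d + 1) → K) (E : Fin (d + 1) → Module.End K V) : Prop where
  injective : Function.Injective θ
  hasEigenvalue_iff : ∀ μ : K, A.HasEigenvalue μ ↔ ∃ i, θ i = μ
  apply_eq : ∀ i j, ∀ v ∈ Module.End.eigenspace A (θ j), E i v = if i = j then v else 0

/-- A thin Hessenberg system `(A; {E_i}; A*; {E*_i})` of diameter `d` on `V`. -/
structure THSystem (K V : Type*) [Field K] [AddCommGroup V] [Module K V] (d : ℕ) where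
  A : Module.End K V
  E : Fin (d + 1) → Module.End K V
  Astar : Module.End K V
  Estar : Fin (d + 1) → Module.End K V
  finrank_eq : Module.finrank K V = d + 1
  multFree : IsMultiplicityFree A
  multFree_star : IsMultiplicityFree Astar
  primitive : ∃ θ : Fin (d + 1) → K, IsPrimitiveIdempotents A θ E
  primitive_star : ∃ θ : Fin (d + 1) → K, IsPrimitiveIdempotents Astar θ Estar
  hess_zero : ∀ i j : Fin (d + 1), (j : ℕ) + 1 < i → E i * Astar * E j = 0
  hess_ne_zero : ∀ i j : Fin (d + 1), (j : ℕ) + 1 = i → E i * Astar * E j ≠ 0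
  hess_star_zero : ∀ i j : Fin (d + 1), (j : ℕ) + 1 < i → Estar i * A * Estar j = 0
  hess_star_ne_zero : ∀ i j : Fin (d + 1), (j : ℕ) + 1 = i → Estar i * A * Estar j ≠ 0

namespace IsPrimitiveIdempotents

variable {K V : Type*} [Field K] [AddCommGroup V] [Module K V] {d : ℕ}
  {A : Module.End K V} {θ : Fin (d + 1) → K} {E : Fin (d + 1) → Module.End K V}

theorem hom_ext (h : IsPrimitiveIdempotents A θ E) (hA : IsMultiplicityFree A)
    {f g : Module.End K V}
    (hfg : ∀ j, ∀ v ∈ Module.End.eigenspace A (θ j), f v = g v) : f = g := by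
  have key : (⊤ : Submodule K V) ≤ LinearMap.eqLocus f g := by
    rw [← hA.span_eigenspaces]
    refine iSup_le fun μ v hv => ?_
    by_cases hv0 : v = 0
    · simp [hv0]
    · obtain ⟨i, rfl⟩ := (h.hasEigenvalue_iff μ).1
        (Module.End.hasEigenvalue_of_hasEigenvector ⟨hv, hv0⟩)
      exact hfg i v hv
  ext v
  exact key (Submodule.mem_top : v ∈ ⊤)

theorem sum_eq_one (h : IsPrimitiveIdempotents A θ E) (hA : IsMultiplicityFree A) :
    ∑ i, E i = 1 := by
  refine h.hom_ext hA fun j v hv => ?_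
  rw [LinearMap.sum_apply, Finset.sum_congr rfl fun i _ => h.apply_eq i j v hv]
  simp

theorem mul_E (h : IsPrimitiveIdempotents A θ E) (hA : IsMultiplicityFree A) (i j : Fin (d + 1)) :
    E i * E j = if i = j then E i else 0 := by
  refine h.hom_ext hA fun k v hv => ?_
  rw [Module.End.mul_apply, h.apply_eq j k v hv]
  by_cases hjk : j = k
  · subst hjk
    by_cases hij : i = j <;> simp [hij, h.apply_eq _ _ v hv]
  · by_cases hij : i = j
    · subst hij
      simp [hjk, h.apply_eq _ _ v hv]
    · simp [hij, hjk]

theorem A_mul_E (h : IsPrimitiveIdempotents A θ E) (hA : IsMultiplicityFree A) (i : Fin (d + 1)) :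
    A * E i = θ i • E i := by
  refine h.hom_ext hA fun k v hv => ?_
  rw [Module.End.mul_apply, LinearMap.smul_apply, h.apply_eq i k v hv]
  by_cases hik : i = k
  · subst hik
    simpa using Module.End.mem_eigenspace_iff.1 hv
  · simp [hik]

theorem E_mul_A (h : IsPrimitiveIdempotents A θ E) (hA : IsMultiplicityFree A) (i : Fin (d + 1)) :
    E i * A = θ i • E i := by
  refine h.hom_ext hA fun k v hv => ?_
  rw [Module.End.mul_apply, LinearMap.smul_apply, Module.End.mem_eigenspace_iff.1 hv, map_smul,
    h.apply_eq i k v hv]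
  by_cases hik : i = k
  · simp [hik]
  · simp [hik]

theorem E_ne_zero (h : IsPrimitiveIdempotents A θ E) (i : Fin (d + 1)) : E i ≠ 0 := by
  obtain ⟨v, hv⟩ := ((h.hasEigenvalue_iff (θ i)).2 ⟨i, rfl⟩).exists_hasEigenvector
  intro h0
  have := h.apply_eq i i v hv.1
  rw [h0] at this
  exact hv.2 (by simpa using this.symm)

theorem E_mem (h : IsPrimitiveIdempotents A θ E) (hA : IsMultiplicityFree A) (i : Fin (d + 1))
    (v : V) : E i v ∈ Module.End.eigenspace A (θ i) := by
  rw [Module.End.mem_eigenspace_iff]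
  simpa using LinearMap.congr_fun (h.A_mul_E hA i) v

theorem exists_smul (h : IsPrimitiveIdempotents A θ E) (hA : IsMultiplicityFree A)
    (i : Fin (d + 1)) {v : V} (hv : E i v ≠ 0) (w : V) : ∃ c : K, E i w = c • E i v := by
  have h1 := hA.finrank_eigenspace (θ i) ((h.hasEigenvalue_iff _).2 ⟨i, rfl⟩)
  have h2 := (finrank_eq_one_iff_of_nonzero'
    (⟨E i v, h.E_mem hA i v⟩ : Module.End.eigenspace A (θ i))
    (by simpa [Subtype.ext_iff] using hv)).1 h1 ⟨E i w, h.E_mem hA i w⟩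
  obtain ⟨c, hc⟩ := h2
  exact ⟨c, by simpa [Subtype.ext_iff] using hc.symm⟩

/-- The algebraic relations characterizing primitive idempotents. -/
theorem of_relations (hdim : Module.finrank K V = d + 1) (hθ : Function.Injective θ)
    (hsum : ∑ i, E i = 1) (hAE : ∀ i, A * E i = θ i • E i) (hEA : ∀ i, E i * A = θ i • E i)
    (h0 : ∀ i, E i ≠ 0) : IsMultiplicityFree A ∧ IsPrimitiveIdempotents A θ E := by
  have : FiniteDimensional K V := Module.finite_of_finrank_pos (by omega)
  have hdec : ∀ v, ∑ i, E i v = v := fun v => by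
    have := LinearMap.congr_fun hsum v
    simpa [LinearMap.sum_apply] using this
  have hmem : ∀ i v, E i v ∈ Module.End.eigenspace A (θ i) := fun i v => by
    rw [Module.End.mem_eigenspace_iff]
    simpa using LinearMap.congr_fun (hAE i) v
  have hoff : ∀ i (μ : K), θ i ≠ μ → ∀ v ∈ Module.End.eigenspace A μ, E i v = 0 := by
    intro i μ hμ v hv
    have h1 := LinearMap.congr_fun (hEA i) v
    rw [Module.End.mul_apply, Module.End.mem_eigenspace_iff.1 hv, map_smul, LinearMap.smul_apply,
      ← sub_eq_zero, ← sub_smul] at h1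
    exact (smul_eq_zero.1 h1).resolve_left (sub_ne_zero.2 hμ.symm)
  have happ : ∀ i j, ∀ v ∈ Module.End.eigenspace A (θ j), E i v = if i = j then v else 0 := by
    intro i j v hv
    split_ifs with hij
    · subst hij
      conv_rhs => rw [← hdec v]
      exact (Finset.sum_eq_single i (fun k _ hk => hoff k _ (fun h => hk (hθ h)) v hv)
        (by simp)).symm
    · exact hoff i _ (fun h => hij (hθ h)) v hv
  have hex : ∀ i, ∃ v, E i v ≠ 0 := fun i => by
    by_contra! hcon
    exact h0 i (LinearMap.ext hcon)
  choose x hx using hex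
  have hev : ∀ μ : K, A.HasEigenvalue μ ↔ ∃ i, θ i = μ := by
    intro μ
    constructor
    · intro hμ
      obtain ⟨v, hv⟩ := hμ.exists_hasEigenvector
      by_contra! hcon
      exact hv.2 (by rw [← hdec v]; exact Finset.sum_eq_zero fun i _ => hoff i μ (hcon i) v hv.1)
    · rintro ⟨i, rfl⟩
      exact Module.End.hasEigenvalue_of_hasEigenvector ⟨hmem i (x i), hx i⟩
  refine ⟨⟨?_, ?_⟩, ⟨hθ, hev, happ⟩⟩
  · rw [eq_top_iff]
    intro v _
    rw [← hdec v]
    exact Submodule.sum_mem _ fun i _ => Submodule.mem_iSup_of_mem (θ i) (hmem i v)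
  · intro μ hμ
    obtain ⟨i, rfl⟩ := (hev μ).1 hμ
    have hli : LinearIndependent K fun j => E j (x j) :=
      Module.End.eigenvectors_linearIndependent' A θ hθ _ fun j => ⟨hmem j (x j), hx j⟩
    let b := basisOfLinearIndependentOfCardEqFinrank hli (by simp [hdim])
    refine (finrank_eq_one_iff_of_nonzero'
      (⟨E i (x i), hmem i (x i)⟩ : Module.End.eigenspace A (θ i))
      (by simpa [Subtype.ext_iff] using hx i)).2 fun w => ⟨b.repr w i, ?_⟩
    have h1 : E i w = w := by simpa using happ i i w w.2
    have h2 : E i (∑ j, b.repr w j • b j) = b.repr w i • E i (x i) := by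
      rw [map_sum]
      rw [Finset.sum_eq_single i]
      · simp [b, happ i i _ (hmem i (x i))]
      · intro j _ hj
        simp [b, happ i j _ (hmem j (x j)), hj.symm]
      · simp
    rw [b.sum_repr] at h2
    ext
    simp [← h2, h1]

end IsPrimitiveIdempotents

namespace THSystem

variable {K V : Type*} [Field K] [AddCommGroup V] [Module K V] {d : ℕ}

/-! ### Eigenvalue sequences and relatives -/

/-- The eigenvalue sequence: `θ i` is the eigenvalue of `A` corresponding to `E i`. -/
def theta (Φ : THSystem K V d) : Fin (d + 1) → K := Φ.primitive.choose

theorem theta_spec (Φ : THSystem K V d) : IsPrimitiveIdempotents Φ.A Φ.theta Φ.E :=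
  Φ.primitive.choose_spec

/-- The relative `Φ* = (A*; {E*_i}; A; {E_i})`. -/
def star (Φ : THSystem K V d) : THSystem K V d where
  A := Φ.Astar
  E := Φ.Estar
  Astar := Φ.A
  Estar := Φ.E
  finrank_eq := Φ.finrank_eq
  multFree := Φ.multFree_star
  multFree_star := Φ.multFree
  primitive := Φ.primitive_star
  primitive_star := Φ.primitive
  hess_zero := Φ.hess_star_zero
  hess_ne_zero := Φ.hess_star_ne_zero
  hess_star_zero := Φ.hess_zero
  hess_star_ne_zero := Φ.hess_ne_zero

/-- The dual eigenvalue sequence: `θ* i` is the eigenvalue of `A*` corresponding to `E* i`. -/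
def thetaStar (Φ : THSystem K V d) : Fin (d + 1) → K := Φ.star.theta

theorem dual_eq_zero {f : Module.End K V} (h : f.dualMap = 0) : f = 0 := by
  ext v
  rw [LinearMap.zero_apply, ← Module.forall_dual_apply_eq_zero_iff K]
  intro g
  simpa using LinearMap.congr_fun (LinearMap.congr_fun h g) v

theorem dual_mul (X Y Z : Module.End K V) :
    X.dualMap * Y.dualMap * Z.dualMap = LinearMap.dualMap (Z * Y * X) := rfl

theorem dual_aux (Φ : THSystem K V d) :
    IsMultiplicityFree Φ.A.dualMap ∧
      IsPrimitiveIdempotents Φ.A.dualMap (fun i => Φ.theta i.rev)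
        (fun i => (Φ.E i.rev).dualMap) := by
  have : FiniteDimensional K V := Module.finite_of_finrank_pos (by rw [Φ.finrank_eq]; omega)
  have h := Φ.theta_spec
  have hA := Φ.multFree
  refine IsPrimitiveIdempotents.of_relations ?_ ?_ ?_ ?_ ?_ ?_
  · rw [Subspace.dual_finrank_eq, Φ.finrank_eq]
  · exact h.injective.comp Fin.rev_injective
  · ext f v
    have h1 : ∑ i, (Φ.E (Fin.rev i)) v = v := by
      have h2 := LinearMap.congr_fun (h.sum_eq_one hA) v
      rw [LinearMap.sum_apply] at h2
      rw [← Equiv.sum_comp Fin.revPerm] at h2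
      simpa using h2
    have h3 := congrArg f h1
    rw [map_sum] at h3
    simpa [LinearMap.sum_apply] using h3
  · intro i
    ext f v
    have h1 := congrArg f (LinearMap.congr_fun (h.E_mul_A hA i.rev) v)
    simpa using h1
  · intro i
    ext f v
    have h1 := congrArg f (LinearMap.congr_fun (h.A_mul_E hA i.rev) v)
    simpa using h1
  · intro i h0
    exact h.E_ne_zero i.rev (dual_eq_zero h0)

/-- The relative `Φ~ = (A^σ; {E_{d-i}^σ}; A*^σ; {E*_{d-i}^σ})` on the dual space of `V`, where `σ`
is the canonical anti-isomorphism, sending a map to its transpose `f ↦ f ∘ S`. -/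
def tilde (Φ : THSystem K V d) : THSystem K (Module.Dual K V) d where
  A := Φ.A.dualMap
  E i := (Φ.E i.rev).dualMap
  Astar := Φ.Astar.dualMap
  Estar i := (Φ.Estar i.rev).dualMap
  finrank_eq := by rw [Subspace.dual_finrank_eq, Φ.finrank_eq]
  multFree := Φ.dual_aux.1
  multFree_star := Φ.star.dual_aux.1
  primitive := ⟨_, Φ.dual_aux.2⟩
  primitive_star := ⟨_, Φ.star.dual_aux.2⟩
  hess_zero i j hij := by
    rw [dual_mul, Φ.hess_zero j.rev i.rev (by simp only [Fin.val_rev]; omega)]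
    exact LinearMap.ext fun f => LinearMap.ext fun v => map_zero f
  hess_ne_zero i j hij h := by
    rw [dual_mul] at h
    exact Φ.hess_ne_zero j.rev i.rev (by simp only [Fin.val_rev]; omega) (dual_eq_zero h)
  hess_star_zero i j hij := by
    rw [dual_mul, Φ.hess_star_zero j.rev i.rev (by simp only [Fin.val_rev]; omega)]
    exact LinearMap.ext fun f => LinearMap.ext fun v => map_zero f
  hess_star_ne_zero i j hij h := by
    rw [dual_mul] at h
    exact Φ.hess_star_ne_zero j.rev i.rev (by simp only [Fin.val_rev]; omega) (dual_eq_zero h)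

/-! ### The polynomials `τ_i`, `η_i` and the scalars `ℓ_i`, `ν` -/

/-- `τ_i = ∏_{h < i} (λ - θ_h)`. -/
def tau (Φ : THSystem K V d) (i : ℕ) : K[X] :=
  ∏ h ∈ Finset.univ.filter (fun h : Fin (d + 1) => (h : ℕ) < i), (X - C (Φ.theta h))

/-- `η_i = ∏_{h < i} (λ - θ_{d-h})`. -/
def eta (Φ : THSystem K V d) (i : ℕ) : K[X] :=
  ∏ h ∈ Finset.univ.filter (fun h : Fin (d + 1) => (h : ℕ) < i), (X - C (Φ.theta h.rev))

/-- `ℓ_i = η*_d(θ*_0) / (τ*_i(θ*_i) η*_{d-i}(θ*_i))`. -/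
def ell (Φ : THSystem K V d) (i : Fin (d + 1)) : K :=
  (Φ.star.eta d).eval (Φ.thetaStar 0) /
    ((Φ.star.tau i).eval (Φ.thetaStar i) * (Φ.star.eta (d - i)).eval (Φ.thetaStar i))

/-- `ν` is the reciprocal of the trace of `E_0 E*_0`. -/
def nu (Φ : THSystem K V d) : K :=
  (LinearMap.trace K V (Φ.E 0 * Φ.Estar 0))⁻¹

/-! ### Standard bases -/

theorem sum_E_apply (Φ : THSystem K V d) (v : V) : ∑ i, Φ.E i v = v := by
  simpa [LinearMap.sum_apply] using
    LinearMap.congr_fun (Φ.theta_spec.sum_eq_one Φ.multFree) v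

theorem E_E_apply (Φ : THSystem K V d) (i j : Fin (d + 1)) (v : V) :
    Φ.E i (Φ.E j v) = if i = j then Φ.E i v else 0 := by
  have := LinearMap.congr_fun (Φ.theta_spec.mul_E Φ.multFree i j) v
  rw [Module.End.mul_apply] at this
  rw [this]
  split_ifs <;> rfl

theorem eq_zero_of_E (Φ : THSystem K V d) {v : V} (h : ∀ i, Φ.E i v = 0) : v = 0 := by
  rw [← Φ.sum_E_apply v]
  exact Finset.sum_eq_zero fun i _ => h i

theorem E_A_apply (Φ : THSystem K V d) (i : Fin (d + 1)) (v : V) :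
    Φ.E i (Φ.A v) = Φ.theta i • Φ.E i v :=
  LinearMap.congr_fun (Φ.theta_spec.E_mul_A Φ.multFree i) v

theorem E_aeval_apply (Φ : THSystem K V d) (i : Fin (d + 1)) (q : K[X]) (v : V) :
    Φ.E i (aeval Φ.A q v) = q.eval (Φ.theta i) • Φ.E i v := by
  induction q using Polynomial.induction_on' with
  | add p q hp hq => simp [hp, hq, add_smul]
  | monomial n a =>
    induction n generalizing v with
    | zero => simp [Algebra.algebraMap_eq_smul_one]
    | succ n ih =>
      have h1 : aeval Φ.A (monomial (n + 1) a) v = aeval Φ.A (monomial n a) (Φ.A v) := by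
        rw [← Module.End.mul_apply]
        congr 1
        simp [aeval_monomial, pow_succ, mul_assoc]
      rw [h1, ih, E_A_apply, smul_smul]
      simp [pow_succ, mul_assoc]

theorem raise (Φ : THSystem K V d) (m : ℕ) (c : K) {v : V}
    (hv : ∀ l : Fin (d + 1), m < l → Φ.E l v = 0) :
    (∀ l : Fin (d + 1), m + 1 < l → Φ.E l (Φ.Astar v - c • v) = 0) ∧
    (∀ k j : Fin (d + 1), (k : ℕ) = m + 1 → (j : ℕ) = m → Φ.E j v ≠ 0 →
      Φ.E k (Φ.Astar v - c • v) ≠ 0) := by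
  have hexp : ∀ k, Φ.E k (Φ.Astar v) = ∑ j, (Φ.E k * Φ.Astar * Φ.E j) v := by
    intro k
    conv_lhs => rw [← Φ.sum_E_apply v]
    simp [map_sum]
  constructor
  · intro l hl
    rw [map_sub, map_smul, hv l (by omega), hexp, smul_zero, sub_zero]
    refine Finset.sum_eq_zero fun j _ => ?_
    by_cases hj : m < j
    · simp [hv j hj]
    · rw [Φ.hess_zero l j (by omega)]
      rfl
  · intro k j hk hj hne
    rw [map_sub, map_smul, hv k (by omega), hexp, smul_zero, sub_zero,
      Finset.sum_eq_single j]
    · intro h0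
      refine Φ.hess_ne_zero k j (by omega) (LinearMap.ext fun w => ?_)
      obtain ⟨c, hc⟩ := Φ.theta_spec.exists_smul Φ.multFree j hne w
      simp only [Module.End.mul_apply] at h0 ⊢
      rw [hc, map_smul, map_smul, h0, smul_zero, LinearMap.zero_apply]
    · intro i _ hij
      have hij' : (i : ℕ) ≠ j := fun h => hij (Fin.ext h)
      by_cases hi : m < i
      · simp [hv i hi]
      · rw [Φ.hess_zero k i (by omega)]
        rfl
    · simp

theorem raise_prod (Φ : THSystem K V d) (m : ℕ) (a : Fin (d + 1) → K) {v : V}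
    (hv : ∀ l : Fin (d + 1), m < l → Φ.E l v = 0) (S : Finset (Fin (d + 1))) :
    (∀ l : Fin (d + 1), m + S.card < l →
      Φ.E l (aeval Φ.Astar (∏ k ∈ S, (X - C (a k))) v) = 0) ∧
    (∀ k j : Fin (d + 1), (k : ℕ) = m + S.card → (j : ℕ) = m → Φ.E j v ≠ 0 →
      Φ.E k (aeval Φ.Astar (∏ k ∈ S, (X - C (a k))) v) ≠ 0) := by
  induction S using Finset.induction_on with
  | empty =>
    refine ⟨by simpa using hv, fun k j hk hj hne => ?_⟩
    obtain rfl : k = j := Fin.ext (by simpa [hj] using hk)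
    simpa using hne
  | insert b S hb ih =>
    have hstep : aeval Φ.Astar (∏ k ∈ insert b S, (X - C (a k))) v =
        Φ.Astar (aeval Φ.Astar (∏ k ∈ S, (X - C (a k))) v) -
          a b • aeval Φ.Astar (∏ k ∈ S, (X - C (a k))) v := by
      rw [Finset.prod_insert hb, map_mul, Module.End.mul_apply]
      simp [Algebra.algebraMap_eq_smul_one]
    rw [hstep, Finset.card_insert_of_notMem hb]
    obtain ⟨h1, h2⟩ := Φ.raise _ (a b) ih.1
    refine ⟨fun l hl => h1 l (by omega), fun k j hk hj hne => ?_⟩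
    exact h2 k ⟨m + S.card, by omega⟩ (by omega) rfl (ih.2 _ j rfl hj hne)

theorem E_of_mem_range (Φ : THSystem K V d) {ξ : V} (hξ : ξ ∈ LinearMap.range (Φ.E 0))
    (l : Fin (d + 1)) : Φ.E l ξ = if l = 0 then ξ else 0 := by
  obtain ⟨w, rfl⟩ := hξ
  rw [E_E_apply]
  split_ifs with h
  · rw [h]
  · rfl

theorem Estar_ne_zero (Φ : THSystem K V d) {ξ : V} (hξ : ξ ∈ LinearMap.range (Φ.E 0))
    (h0 : ξ ≠ 0) (i : Fin (d + 1)) : Φ.Estar i ξ ≠ 0 := by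
  intro hi
  have hE := Φ.E_of_mem_range hξ
  have h1 := (Φ.raise_prod 0 Φ.thetaStar (v := ξ)
    (fun l hl => by rw [hE, if_neg (by rintro rfl; simp at hl)])
    (Finset.univ.erase i)).2 (Fin.last d) 0 (by simp) rfl (by rw [hE, if_pos rfl]; exact h0)
  refine h1 ?_
  rw [Φ.star.eq_zero_of_E (v := aeval Φ.Astar _ ξ), map_zero]
  intro k
  refine (Φ.star.E_aeval_apply k _ ξ).trans ?_
  by_cases hk : k = i
  · subst hk
    exact smul_eq_zero_of_right _ hi
  · rw [eval_prod, Finset.prod_eq_zero (Finset.mem_erase.2 ⟨hk, Finset.mem_univ k⟩), zero_smul]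
    simp [thetaStar]

/-- The `Φ`-standard basis `{E*_i ξ}` attached to a nonzero vector `ξ` of `E_0 V`. -/
def standardBasis (Φ : THSystem K V d) (ξ : V) (hξ : ξ ∈ LinearMap.range (Φ.E 0)) (h0 : ξ ≠ 0) :
    Module.Basis (Fin (d + 1)) K V :=
  basisOfLinearIndependentOfCardEqFinrank (b := fun i => Φ.Estar i ξ)
    (Module.End.eigenvectors_linearIndependent' Φ.Astar Φ.thetaStar Φ.star.theta_spec.injective _
      fun i => ⟨Φ.star.theta_spec.E_mem Φ.star.multFree i ξ, Φ.Estar_ne_zero hξ h0 i⟩)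
    (by simp [Φ.finrank_eq])

theorem standardBasis_apply (Φ : THSystem K V d) (ξ : V) (hξ : ξ ∈ LinearMap.range (Φ.E 0))
    (h0 : ξ ≠ 0) (i : Fin (d + 1)) : Φ.standardBasis ξ hξ h0 i = Φ.Estar i ξ := by
  simp [standardBasis]

theorem exists_xi (Φ : THSystem K V d) : ∃ ξ : V, ξ ∈ LinearMap.range (Φ.E 0) ∧ ξ ≠ 0 := by
  by_contra! hcon
  exact Φ.theta_spec.E_ne_zero 0 (LinearMap.ext fun v => hcon _ ⟨v, rfl⟩)

/-- A nonzero vector of `E_0 V`; the objects defined through it do not depend on its choice. -/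
def xi (Φ : THSystem K V d) : V := Φ.exists_xi.choose

theorem xi_mem (Φ : THSystem K V d) : Φ.xi ∈ LinearMap.range (Φ.E 0) := Φ.exists_xi.choose_spec.1

theorem xi_ne_zero (Φ : THSystem K V d) : Φ.xi ≠ 0 := Φ.exists_xi.choose_spec.2

theorem exists_smul_xi (Φ : THSystem K V d) {ξ : V} (hξ : ξ ∈ LinearMap.range (Φ.E 0))
    (h0 : ξ ≠ 0) : ∃ c : K, c ≠ 0 ∧ ξ = c • Φ.xi := by
  have h1 : Φ.E 0 Φ.xi = Φ.xi := by simpa using Φ.E_of_mem_range Φ.xi_mem 0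
  have h2 : Φ.E 0 ξ = ξ := by simpa using Φ.E_of_mem_range hξ 0
  obtain ⟨c, hc⟩ := Φ.theta_spec.exists_smul Φ.multFree 0 (v := Φ.xi)
    (by rw [h1]; exact Φ.xi_ne_zero) ξ
  rw [h1, h2] at hc
  exact ⟨c, by rintro rfl; exact h0 (by simpa using hc), hc⟩

/-! ### The transition matrix `P` -/

theorem Estar_mem_range (Φ : THSystem K V d) (ξ : V) :
    Φ.Estar 0 ξ ∈ LinearMap.range (Φ.star.E 0) := ⟨ξ, rfl⟩

/-- The transition matrix from the `Φ*`-standard basis `{E_i ξ*}` to the `Φ`-standard basis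
`{E*_i ξ}`, where `ξ* = E*_0 ξ`; its `j`-th column expands `E*_j ξ` in the basis `{E_i ξ*}`. -/
def transMat (Φ : THSystem K V d) (ξ : V) (hξ : ξ ∈ LinearMap.range (Φ.E 0)) (h0 : ξ ≠ 0) :
    Matrix (Fin (d + 1)) (Fin (d + 1)) K :=
  (Φ.star.standardBasis (Φ.Estar 0 ξ) (Φ.Estar_mem_range ξ) (Φ.Estar_ne_zero hξ h0 0)).toMatrix
    (Φ.standardBasis ξ hξ h0)

/-- The west normalized transition matrix `P` of `Φ`. -/
def P (Φ : THSystem K V d) : Matrix (Fin (d + 1)) (Fin (d + 1)) K :=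
  Φ.transMat Φ.xi Φ.xi_mem Φ.xi_ne_zero

theorem P_eq_transMat (Φ : THSystem K V d) (ξ : V) (hξ : ξ ∈ LinearMap.range (Φ.E 0))
    (h0 : ξ ≠ 0) : Φ.P = Φ.transMat ξ hξ h0 := by
  obtain ⟨c, hc, rfl⟩ := Φ.exists_smul_xi hξ h0
  symm
  ext i j
  set b := Φ.star.standardBasis (Φ.Estar 0 Φ.xi) (Φ.Estar_mem_range Φ.xi)
    (Φ.Estar_ne_zero Φ.xi_mem Φ.xi_ne_zero 0) with hb
  set b' := Φ.star.standardBasis (Φ.Estar 0 (c • Φ.xi)) (Φ.Estar_mem_range (c • Φ.xi))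
    (Φ.Estar_ne_zero hξ h0 0) with hb'
  have hbb : ∀ i, b' i = c • b i := fun i => by
    rw [hb, hb', standardBasis_apply, standardBasis_apply, map_smul, map_smul]
  have hP : ∀ j, ∑ i, Φ.P i j • b i = Φ.Estar j Φ.xi := fun j => by
    rw [← Φ.standardBasis_apply Φ.xi Φ.xi_mem Φ.xi_ne_zero j]
    exact b.sum_toMatrix_smul_self _ j
  have h3 : Φ.Estar j (c • Φ.xi) = ∑ i, Φ.P i j • b' i := by
    rw [map_smul, ← hP j, Finset.smul_sum]
    exact Finset.sum_congr rfl fun i _ => by rw [hbb, smul_comm]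
  rw [transMat, Module.Basis.toMatrix_apply, standardBasis_apply, h3, ← hb',
    Module.Basis.repr_sum_self]

end THSystem

/-! ### The polynomials of a Hessenberg matrix -/

/-- The polynomials `f_0, …, f_{d+1}` of a Hessenberg matrix `H`, given by `f_0 = 1`,
`λ f_j = ∑_{i ≤ j+1} H_{ij} f_i` for `j < d` and
`λ f_d = c⁻¹ f_{d+1} + ∑_{i ≤ d} H_{id} f_i`, where `c = ∏_{i=1}^d H_{i,i-1}`. The equations are
solved for `f_{j+1}`; only the indices `0, …, d+1` are meaningful. -/
def hessPoly {K : Type*} [Field K] {d : ℕ} (H : Matrix (Fin (d + 1)) (Fin (d + 1)) K) : ℕ → K[X]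
  | 0 => 1
  | j + 1 =>
    if hj : j < d then
      C (H ⟨j + 1, by omega⟩ ⟨j, by omega⟩)⁻¹ *
        (X * hessPoly H j - ∑ i : Fin (j + 1), C (H ⟨i, by omega⟩ ⟨j, by omega⟩) * hessPoly H i)
    else if hj : j = d then
      C (∏ i : Fin d, H i.succ i.castSucc) *
        (X * hessPoly H j - ∑ i : Fin (j + 1), C (H ⟨i, by omega⟩ ⟨j, by omega⟩) * hessPoly H i)
    else 0

theorem hessPoly_spec {K : Type*} [Field K] {d : ℕ} (H : Matrix (Fin (d + 1)) (Fin (d + 1)) K)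
    (hH : ∀ i : Fin d, H i.succ i.castSucc ≠ 0) :
    hessPoly H 0 = 1 ∧
    (∀ j : Fin d, X * hessPoly H j =
      ∑ i : Fin (j + 2), C (H ⟨i, by omega⟩ j.castSucc) * hessPoly H i) ∧
    X * hessPoly H d = C (∏ i : Fin d, H i.succ i.castSucc)⁻¹ * hessPoly H (d + 1) +
      ∑ i : Fin (d + 1), C (H i (Fin.last d)) * hessPoly H i := by
  refine ⟨by rw [hessPoly], fun j => ?_, ?_⟩
  · rw [Fin.sum_univ_castSucc]
    simp only [Fin.val_castSucc, Fin.val_last]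
    rw [hessPoly, dif_pos j.2, ← mul_assoc, ← C_mul]
    have h1 : H ⟨j + 1, by omega⟩ j.castSucc * (H ⟨j + 1, by omega⟩ ⟨j, by omega⟩)⁻¹ = 1 :=
      mul_inv_cancel₀ (hH j)
    rw [h1, C_1, one_mul]
    exact (add_sub_cancel _ _).symm
  · rw [hessPoly, dif_neg (lt_irrefl d), dif_pos rfl, ← mul_assoc, ← C_mul,
      inv_mul_cancel₀ (Finset.prod_ne_zero_iff.2 fun i _ => hH i), C_1, one_mul]
    exact (sub_add_cancel _ _).symm

namespace THSystem

variable {K V : Type*} [Field K] [AddCommGroup V] [Module K V] {d : ℕ}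

/-! ### The polynomials `s_i` and `t_i` -/

/-- The matrix representing `A` with respect to the `Φ`-standard basis attached to `ξ`. -/
def stdMat (Φ : THSystem K V d) (ξ : V) (hξ : ξ ∈ LinearMap.range (Φ.E 0)) (h0 : ξ ≠ 0) :
    Matrix (Fin (d + 1)) (Fin (d + 1)) K :=
  LinearMap.toMatrix (Φ.standardBasis ξ hξ h0) (Φ.standardBasis ξ hξ h0) Φ.A

/-- The matrix representing `A` with respect to a `Φ`-standard basis. -/
def H (Φ : THSystem K V d) : Matrix (Fin (d + 1)) (Fin (d + 1)) K :=
  Φ.stdMat Φ.xi Φ.xi_mem Φ.xi_ne_zero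

theorem H_eq_stdMat (Φ : THSystem K V d) (ξ : V) (hξ : ξ ∈ LinearMap.range (Φ.E 0))
    (h0 : ξ ≠ 0) : Φ.H = Φ.stdMat ξ hξ h0 := by
  obtain ⟨c, hc, rfl⟩ := Φ.exists_smul_xi hξ h0
  symm
  ext i j
  set b := Φ.standardBasis Φ.xi Φ.xi_mem Φ.xi_ne_zero with hb
  set b' := Φ.standardBasis (c • Φ.xi) hξ h0 with hb'
  have hbb : ∀ i, b' i = c • b i := fun i => by
    rw [hb, hb', standardBasis_apply, standardBasis_apply, map_smul]
  have hH : ∀ j, ∑ i, Φ.H i j • b i = Φ.A (b j) := fun j => by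
    rw [← b.sum_repr (Φ.A (b j))]
    exact Finset.sum_congr rfl fun i _ => by rw [H, stdMat, LinearMap.toMatrix_apply]
  have h3 : Φ.A (b' j) = ∑ i, Φ.H i j • b' i := by
    rw [hbb, map_smul, ← hH j, Finset.smul_sum]
    exact Finset.sum_congr rfl fun i _ => by rw [hbb, smul_comm]
  rw [stdMat, LinearMap.toMatrix_apply, ← hb', h3, Module.Basis.repr_sum_self]

/-- The polynomials `s_0, …, s_{d+1}` of `Φ`. -/
def s (Φ : THSystem K V d) (i : ℕ) : K[X] := hessPoly Φ.H i

/-- The normalized polynomials: `t_i = s_i / ℓ_i` for `0 ≤ i ≤ d`, and `t_{d+1} = s_{d+1}`. -/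
def t (Φ : THSystem K V d) (i : ℕ) : K[X] :=
  if hi : i < d + 1 then C (Φ.ell ⟨i, hi⟩)⁻¹ * Φ.s i else Φ.s i

/-! ### The split sequence and the matrix `𝒫` -/

/-- `U_i = (E*_0 V + ⋯ + E*_i V) ∩ (E_0 V + ⋯ + E_{d-i} V)`. -/
def splitSpace (Φ : THSystem K V d) (i : Fin (d + 1)) : Submodule K V :=
  (⨆ k : Fin (d + 1), ⨆ _ : k ≤ i, LinearMap.range (Φ.Estar k)) ⊓
    (⨆ k : Fin (d + 1), ⨆ _ : k ≤ i.rev, LinearMap.range (Φ.E k))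

theorem mem_sum_range_iff (Φ : THSystem K V d) (m : Fin (d + 1)) (v : V) :
    v ∈ (⨆ k : Fin (d + 1), ⨆ _ : k ≤ m, LinearMap.range (Φ.E k)) ↔
      ∀ l : Fin (d + 1), m < l → Φ.E l v = 0 := by
  constructor
  · intro hv l hl
    have h1 : (⨆ k : Fin (d + 1), ⨆ _ : k ≤ m, LinearMap.range (Φ.E k)) ≤
        LinearMap.ker (Φ.E l) := by
      refine iSup₂_le fun k hk => ?_
      rintro _ ⟨w, rfl⟩
      rw [LinearMap.mem_ker, E_E_apply, if_neg (by rintro rfl; exact absurd hk (not_le.2 hl))]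
    exact h1 hv
  · intro h
    rw [← Φ.sum_E_apply v]
    refine Submodule.sum_mem _ fun i _ => ?_
    by_cases hi : i ≤ m
    · exact Submodule.mem_iSup_of_mem i (Submodule.mem_iSup_of_mem hi ⟨v, rfl⟩)
    · rw [h i (not_le.1 hi)]
      exact Submodule.zero_mem _

theorem mem_splitSpace_iff (Φ : THSystem K V d) (i : Fin (d + 1)) (v : V) :
    v ∈ Φ.splitSpace i ↔ (∀ l : Fin (d + 1), i < l → Φ.Estar l v = 0) ∧
      ∀ l : Fin (d + 1), i.rev < l → Φ.E l v = 0 := by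
  rw [splitSpace, Submodule.mem_inf, mem_sum_range_iff]
  exact and_congr_left fun _ => Φ.star.mem_sum_range_iff i v

/-- A generator of `U_i`. -/
def splitVec (Φ : THSystem K V d) (i : Fin (d + 1)) : V :=
  aeval Φ.Astar (∏ k ∈ Finset.Ioi i, (X - C (Φ.thetaStar k))) Φ.xi

theorem Estar_splitVec (Φ : THSystem K V d) (i l : Fin (d + 1)) :
    Φ.Estar l (Φ.splitVec i) =
      (∏ k ∈ Finset.Ioi i, (Φ.thetaStar l - Φ.thetaStar k)) • Φ.Estar l Φ.xi := by
  refine (Φ.star.E_aeval_apply l _ Φ.xi).trans ?_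
  rw [eval_prod]
  simp [thetaStar]
  rfl

theorem Estar_splitVec_ne_zero (Φ : THSystem K V d) (i : Fin (d + 1)) :
    Φ.Estar i (Φ.splitVec i) ≠ 0 := by
  rw [Estar_splitVec]
  refine smul_ne_zero (Finset.prod_ne_zero_iff.2 fun k hk => ?_)
    (Φ.Estar_ne_zero Φ.xi_mem Φ.xi_ne_zero i)
  exact sub_ne_zero.2 fun h =>
    absurd (Φ.star.theta_spec.injective h) (Finset.mem_Ioi.1 hk).ne

theorem splitVec_mem (Φ : THSystem K V d) (i : Fin (d + 1)) :
    Φ.splitVec i ∈ Φ.splitSpace i := by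
  rw [mem_splitSpace_iff]
  constructor
  · intro l hl
    rw [Estar_splitVec, Finset.prod_eq_zero (Finset.mem_Ioi.2 hl) (sub_self _), zero_smul]
  · intro l hl
    refine (Φ.raise_prod 0 Φ.thetaStar (v := Φ.xi) (fun l hl => ?_) (Finset.Ioi i)).1 l ?_
    · rw [Φ.E_of_mem_range Φ.xi_mem, if_neg (by rintro rfl; simp at hl)]
    · have := Fin.lt_def.1 hl
      rw [Fin.val_rev] at this
      simp only [Fin.card_Ioi]
      omega

theorem exists_smul_splitVec (Φ : THSystem K V d) (i : Fin (d + 1)) {w : V}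
    (hw : w ∈ Φ.splitSpace i) : ∃ c : K, w = c • Φ.splitVec i := by
  obtain ⟨c, hc⟩ := Φ.star.theta_spec.exists_smul Φ.star.multFree i
    (Φ.Estar_splitVec_ne_zero i) w
  refine ⟨c, ?_⟩
  have hx := (Φ.splitSpace i).sub_mem hw ((Φ.splitSpace i).smul_mem c (Φ.splitVec_mem i))
  rw [mem_splitSpace_iff] at hx
  have hxi : Φ.Estar i (w - c • Φ.splitVec i) = 0 := by
    rw [map_sub, map_smul, sub_eq_zero]
    exact hc
  generalize hxdef : w - c • Φ.splitVec i = x at hx hxi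
  rw [← sub_eq_zero, hxdef]
  by_contra hx0
  classical
  have hne : (Finset.univ.filter fun l => Φ.E l x ≠ 0).Nonempty := by
    by_contra hemp
    refine hx0 (Φ.eq_zero_of_E fun l => ?_)
    by_contra hl
    exact hemp ⟨l, by simp [hl]⟩
  obtain ⟨m, hm, hmax⟩ := Finset.exists_max_image _ id hne
  simp only [Finset.mem_filter, Finset.mem_univ, true_and, id] at hm hmax
  have hmle : m ≤ i.rev := by
    by_contra hcon
    exact hm (hx.2 m (not_le.1 hcon))
  have hmle' := Fin.le_def.1 hmle
  rw [Fin.val_rev] at hmle'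
  refine (Φ.raise_prod m Φ.thetaStar (v := x) (fun l hl => ?_) (Finset.Iio i)).2
    ⟨m + (Finset.Iio i).card, by rw [Fin.card_Iio]; omega⟩ m rfl rfl hm ?_
  · by_contra hcon
    exact absurd (hmax l hcon) (not_le.2 (Fin.lt_def.2 hl))
  · rw [Φ.star.eq_zero_of_E (v := aeval Φ.Astar _ x), map_zero]
    intro k
    refine (Φ.star.E_aeval_apply k _ x).trans ?_
    rcases lt_trichotomy k i with hk | rfl | hk
    · rw [eval_prod, Finset.prod_eq_zero (Finset.mem_Iio.2 hk), zero_smul]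
      simp [thetaStar]
    · exact smul_eq_zero_of_right _ hxi
    · exact smul_eq_zero_of_right _ (hx.1 k hk)

theorem existsUnique_phi (Φ : THSystem K V d) (i : Fin d) :
    ∃! c : K, ∀ w ∈ Φ.splitSpace i.succ,
      (Φ.A - Φ.theta i.castSucc.rev • 1) ((Φ.Astar - Φ.thetaStar i.succ • 1) w) = c • w := by
  have hlow : (Φ.Astar - Φ.thetaStar i.succ • 1) (Φ.splitVec i.succ) =
      Φ.splitVec i.castSucc := by
    have hI : Finset.Ioi i.castSucc = insert i.succ (Finset.Ioi i.succ) := by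
      ext k
      simp only [Finset.mem_Ioi, Finset.mem_insert, Fin.lt_def, Fin.ext_iff, Fin.val_succ,
        Fin.val_castSucc]
      omega
    rw [splitVec, splitVec, hI, Finset.prod_insert (by simp), map_mul, Module.End.mul_apply]
    simp [Algebra.algebraMap_eq_smul_one]
  have hmem := (Φ.mem_splitSpace_iff _ _).1 (Φ.splitVec_mem i.castSucc)
  have hraise : (Φ.A - Φ.theta i.castSucc.rev • 1) (Φ.splitVec i.castSucc) ∈
      Φ.splitSpace i.succ := by
    rw [mem_splitSpace_iff]
    constructor
    · intro l hl
      exact (Φ.star.raise i (Φ.theta i.castSucc.rev) (v := Φ.splitVec i.castSucc)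
        (fun l hl => hmem.1 l (Fin.lt_def.2 hl))).1 l (by simpa using Fin.lt_def.1 hl)
    · intro l hl
      have h1 : Φ.E l ((Φ.A - Φ.theta i.castSucc.rev • 1) (Φ.splitVec i.castSucc)) =
          (Φ.theta l - Φ.theta i.castSucc.rev) • Φ.E l (Φ.splitVec i.castSucc) := by
        simp [E_A_apply, sub_smul]
      rw [h1]
      by_cases hl2 : l = i.castSucc.rev
      · rw [hl2, sub_self, zero_smul]
      · rw [hmem.2 l, smul_zero]
        rw [Fin.ext_iff] at hl2
        simp only [Fin.lt_def, Fin.val_rev, Fin.val_succ, Fin.val_castSucc] at hl hl2 ⊢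
        omega
  obtain ⟨c, hc⟩ := Φ.exists_smul_splitVec i.succ hraise
  refine ⟨c, fun w hw => ?_, fun c' hc' => ?_⟩
  · obtain ⟨b, rfl⟩ := Φ.exists_smul_splitVec i.succ hw
    rw [map_smul, hlow, map_smul, hc, smul_comm]
  · have h1 := hc' _ (Φ.splitVec_mem i.succ)
    rw [hlow, hc] at h1
    refine (smul_left_injective K ?_ h1).symm
    intro h0
    exact Φ.Estar_splitVec_ne_zero i.succ (by rw [h0, map_zero])

/-- The split sequence: `φ_i` is the eigenvalue of `(A - θ_{d-i+1} I)(A* - θ*_i I)` on `U_i`, for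
`1 ≤ i ≤ d`; the scalar `φ_i` is `Φ.phi` at index `i - 1`. -/
def phi (Φ : THSystem K V d) (i : Fin d) : K := (Φ.existsUnique_phi i).choose

/-- The two-variable polynomial `p = ∑_h η_h(λ) τ*_h(μ) / (φ_1 ⋯ φ_h)`, where `λ` and `μ` are the
variables with index `0` and `1`. -/
def twoVarPoly (Φ : THSystem K V d) : MvPolynomial (Fin 2) K :=
  ∑ h : Fin (d + 1), MvPolynomial.C (∏ i ∈ Finset.univ.filter (fun i : Fin d => (i : ℕ) < h), Φ.phi i)⁻¹ *
    (aeval (MvPolynomial.X 0) (Φ.eta h) * aeval (MvPolynomial.X 1) (Φ.star.tau h))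

/-- The west-south normalized transition matrix `𝒫` of `Φ`, with entries `p(θ_i, θ*_j)`. -/
def normP (Φ : THSystem K V d) : Matrix (Fin (d + 1)) (Fin (d + 1)) K :=
  Matrix.of fun i j => MvPolynomial.eval ![Φ.theta i, Φ.thetaStar j] Φ.twoVarPoly

end THSystem

end

/-! All four statements are facts about `P`. Fix nonzero ξ in E_0 V and put ξ* = E*_0 ξ; then E_i
E*_j ξ = P_ij E_i ξ* (`E_Estar_xi`).

The recurrence for s_j is the action of A on the standard basis, so s_j(A) ξ* = E*_j ξ
(`aeval_s_xiStar`), and applying E_i gives P_ij = s_j(θ_i). A degree count shows that the last row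
of P is (ℓ_j) (`P_last`). Pairing the vectors E_i E*_j ξ with a covector that generates a standard
basis for the dual relative computes the same scalars through the matrix of Φ~*; the last rows fix
the normalization, and P_ij/ℓ_j is seen to be symmetric under this duality (`P_div_ell_eq`).

For 𝒫, a divided-difference identity expands E*_j ξ in the split vectors with coefficients
τ*_h(θ*_j) (`nodeProd_smul_Estar_xi`), while E_i of a split vector contributes η_h(θ_i)/(φ_1⋯φ_h)
(`E_splitVec`). Together they give 𝒫_ij = P_ij/ℓ_j (`normP_eq`).

Finally, P and the matrix P* of Φ* are opposite changes of basis up to the factor E_0 ξ* = trace(E_0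
E*_0) ξ, so PP* = P*P = νI. The two orthogonality relations are the entries of these products,
rewritten by duality. -/

/-! ### Eigenvalue sequences of the relatives -/

/-- Needed because `theta` is chosen from an existential: A E_i = θ_i E_i with E_i ≠ 0 pins it down,
so the sequence of a relative can be read off. -/
theorem IsPrimitiveIdempotents.theta_unique {K V : Type*} [Field K] [AddCommGroup V] [Module K V]
    {d : ℕ} {A : Module.End K V} {θ θ' : Fin (d + 1) → K} {E : Fin (d + 1) → Module.End K V}
    (h : IsPrimitiveIdempotents A θ E) (h' : IsPrimitiveIdempotents A θ' E)
    (hA : IsMultiplicityFree A) : θ = θ' := by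
  funext i
  exact smul_left_injective K (h.E_ne_zero i) ((h.A_mul_E hA i).symm.trans (h'.A_mul_E hA i))

namespace THSystem

variable {K V : Type*} [Field K] [AddCommGroup V] [Module K V] {d : ℕ}

theorem theta_tilde (Φ : THSystem K V d) (i : Fin (d + 1)) :
    Φ.tilde.theta i = Φ.theta i.rev :=
  congrFun (Φ.tilde.theta_spec.theta_unique Φ.dual_aux.2 Φ.dual_aux.1) i

/-- The two relatives commute definitionally: `Φ.tilde.star` unfolds to `Φ.star.tilde`. -/
theorem theta_tilde_star (Φ : THSystem K V d) (i : Fin (d + 1)) :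
    Φ.tilde.star.theta i = Φ.thetaStar i.rev :=
  Φ.star.theta_tilde i

/-! ### The scalars `ℓ_i` -/

theorem theta_sub_ne_zero (Φ : THSystem K V d) {i j : Fin (d + 1)} (h : i ≠ j) :
    Φ.theta i - Φ.theta j ≠ 0 :=
  sub_ne_zero.2 fun hij => h (Φ.theta_spec.injective hij)

theorem eval_tau (Φ : THSystem K V d) (i : Fin (d + 1)) (x : K) :
    (Φ.tau i).eval x = ∏ h ∈ Finset.Iio i, (x - Φ.theta h) := by
  rw [tau, eval_prod]
  refine Finset.prod_congr (by ext; simp) fun _ _ => by simp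

theorem eval_eta (Φ : THSystem K V d) (i : Fin (d + 1)) (x : K) :
    (Φ.eta (d - i)).eval x = ∏ h ∈ Finset.Ioi i, (x - Φ.theta h) := by
  rw [eta, eval_prod]
  refine Finset.prod_bij (fun h _ => h.rev) ?_ (fun _ _ _ _ h => Fin.rev_injective h) ?_ ?_
  · intro h hh
    simp only [Finset.mem_filter, Finset.mem_univ, true_and] at hh
    simp only [Finset.mem_Ioi, Fin.lt_def, Fin.val_rev]
    omega
  · intro h hh
    refine ⟨h.rev, ?_, Fin.rev_rev h⟩
    simp only [Finset.mem_Ioi, Fin.lt_def] at hh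
    simp only [Finset.mem_filter, Finset.mem_univ, true_and, Fin.val_rev]
    omega
  · intro h _
    simp

theorem prod_Iio_mul_prod_Ioi (i : Fin (d + 1)) (f : Fin (d + 1) → K) :
    (∏ h ∈ Finset.Iio i, f h) * ∏ h ∈ Finset.Ioi i, f h = ∏ h ∈ Finset.univ.erase i, f h := by
  rw [← Finset.prod_union (Finset.disjoint_left.2 fun h h1 h2 =>
    lt_asymm (Finset.mem_Iio.1 h1) (Finset.mem_Ioi.1 h2))]
  refine Finset.prod_congr ?_ fun _ _ => rfl
  ext h
  simp [lt_or_lt_iff_ne]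

/-- The product `∏_{h ≠ i} (θ*_i - θ*_h)`. -/
noncomputable def nodeProd (Φ : THSystem K V d) (i : Fin (d + 1)) : K :=
  ∏ h ∈ Finset.univ.erase i, (Φ.thetaStar i - Φ.thetaStar h)

theorem nodeProd_ne_zero (Φ : THSystem K V d) (i : Fin (d + 1)) : Φ.nodeProd i ≠ 0 :=
  Finset.prod_ne_zero_iff.2 fun _ hh => Φ.star.theta_sub_ne_zero (Finset.ne_of_mem_erase hh).symm

/-- At θ*_i the factors τ*_i and η*_{d-i} cover the nodes below and above i, hence all nodes but i;
the numerator is the case i = 0. -/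
theorem ell_eq (Φ : THSystem K V d) (i : Fin (d + 1)) :
    Φ.ell i = Φ.nodeProd 0 / Φ.nodeProd i := by
  have h0 := Φ.star.eval_eta 0 (Φ.thetaStar 0)
  have h1 : Finset.Ioi (0 : Fin (d + 1)) = Finset.univ.erase 0 := by
    ext h
    simp
  rw [h1] at h0
  rw [ell, Φ.star.eval_tau, Φ.star.eval_eta, prod_Iio_mul_prod_Ioi]
  simp only [Fin.val_zero, Nat.sub_zero] at h0
  rw [h0]
  rfl

theorem ell_ne_zero (Φ : THSystem K V d) (i : Fin (d + 1)) : Φ.ell i ≠ 0 := by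
  rw [ell_eq]
  exact div_ne_zero (Φ.nodeProd_ne_zero 0) (Φ.nodeProd_ne_zero i)

theorem eval_t (Φ : THSystem K V d) (j : Fin (d + 1)) (x : K) :
    (Φ.t j).eval x = (Φ.s j).eval x / Φ.ell j := by
  rw [t, dif_pos j.2, eval_mul, eval_C, div_eq_inv_mul]

theorem Estar_Estar_apply (Φ : THSystem K V d) (i j : Fin (d + 1)) (v : V) :
    Φ.Estar i (Φ.Estar j v) = if i = j then Φ.Estar i v else 0 :=
  Φ.star.E_E_apply i j v

/-! ### The entries of `P` -/

/-- The vector `ξ* = E*_0 ξ`. -/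
noncomputable def xiStar (Φ : THSystem K V d) : V := Φ.Estar 0 Φ.xi

theorem E_xiStar_ne_zero (Φ : THSystem K V d) (i : Fin (d + 1)) : Φ.E i Φ.xiStar ≠ 0 :=
  Φ.star.Estar_ne_zero (Φ.Estar_mem_range Φ.xi) (Φ.Estar_ne_zero Φ.xi_mem Φ.xi_ne_zero 0) i

theorem Estar_xi_eq_sum (Φ : THSystem K V d) (j : Fin (d + 1)) :
    Φ.Estar j Φ.xi = ∑ i, Φ.P i j • Φ.E i Φ.xiStar := by
  rw [← Φ.standardBasis_apply Φ.xi Φ.xi_mem Φ.xi_ne_zero j]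
  have h := (Φ.star.standardBasis (Φ.Estar 0 Φ.xi) (Φ.Estar_mem_range Φ.xi)
    (Φ.Estar_ne_zero Φ.xi_mem Φ.xi_ne_zero 0)).sum_toMatrix_smul_self
      (Φ.standardBasis Φ.xi Φ.xi_mem Φ.xi_ne_zero) j
  rw [← h]
  refine Finset.sum_congr rfl fun i _ => ?_
  rw [standardBasis_apply]
  rfl

/-- The working form of the definition of P: later identities are proved by applying E_i and
cancelling the nonzero vector E_i ξ*. -/
theorem E_Estar_xi (Φ : THSystem K V d) (i j : Fin (d + 1)) :
    Φ.E i (Φ.Estar j Φ.xi) = Φ.P i j • Φ.E i Φ.xiStar := by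
  rw [Estar_xi_eq_sum, map_sum, Finset.sum_eq_single i]
  · rw [map_smul, E_E_apply, if_pos rfl]
  · intro k _ hk
    rw [map_smul, E_E_apply, if_neg hk.symm, smul_zero]
  · simp

theorem A_Estar_xi (Φ : THSystem K V d) (j : Fin (d + 1)) :
    Φ.A (Φ.Estar j Φ.xi) = ∑ i, Φ.H i j • Φ.Estar i Φ.xi := by
  set b := Φ.standardBasis Φ.xi Φ.xi_mem Φ.xi_ne_zero with hb
  have hbj : ∀ j, b j = Φ.Estar j Φ.xi := Φ.standardBasis_apply Φ.xi Φ.xi_mem Φ.xi_ne_zero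
  rw [← hbj, ← b.sum_repr (Φ.A (b j))]
  exact Finset.sum_congr rfl fun i _ => by rw [H, stdMat, LinearMap.toMatrix_apply, hbj i]

theorem H_smul (Φ : THSystem K V d) (i j : Fin (d + 1)) :
    Φ.H i j • Φ.Estar i Φ.xi = (Φ.Estar i * Φ.A * Φ.Estar j) Φ.xi := by
  rw [Module.End.mul_apply, Module.End.mul_apply, A_Estar_xi, map_sum, Finset.sum_eq_single i]
  · rw [map_smul, Estar_Estar_apply, if_pos rfl]
  · intro k _ hk
    rw [map_smul, Estar_Estar_apply, if_neg hk.symm, smul_zero]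
  · simp

theorem H_eq_zero (Φ : THSystem K V d) {i j : Fin (d + 1)} (h : (j : ℕ) + 1 < i) :
    Φ.H i j = 0 := by
  have h1 := Φ.H_smul i j
  rw [Φ.hess_star_zero i j h, LinearMap.zero_apply] at h1
  exact (smul_eq_zero.1 h1).resolve_right (Φ.Estar_ne_zero Φ.xi_mem Φ.xi_ne_zero i)

theorem H_ne_zero (Φ : THSystem K V d) (i : Fin d) : Φ.H i.succ i.castSucc ≠ 0 := by
  intro h0
  have h1 := Φ.H_smul i.succ i.castSucc
  rw [h0, zero_smul] at h1
  refine Φ.hess_star_ne_zero i.succ i.castSucc (by simp) (LinearMap.ext fun w => ?_)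
  -- E*_j V is a line spanned by E*_j ξ, so a product ending in E*_j that kills ξ is zero.
  obtain ⟨c, hc⟩ := Φ.star.theta_spec.exists_smul Φ.star.multFree i.castSucc
    (Φ.Estar_ne_zero Φ.xi_mem Φ.xi_ne_zero i.castSucc) w
  change Φ.Estar _ w = c • Φ.Estar _ Φ.xi at hc
  simp only [Module.End.mul_apply] at h1 ⊢
  rw [hc, map_smul, map_smul, ← h1, smul_zero, LinearMap.zero_apply]

/-- Evaluated at A and applied to ξ*, the recurrence for s_j becomes column j of H; the known terms
cancel and the nonzero subdiagonal entry isolates the new one. -/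
theorem aeval_s_xiStar (Φ : THSystem K V d) (j : ℕ) (hj : j < d + 1) :
    aeval Φ.A (Φ.s j) Φ.xiStar = Φ.Estar ⟨j, hj⟩ Φ.xi := by
  induction j using Nat.strong_induction_on with
  | _ j ih =>
    cases j with
    | zero =>
      rw [s, (hessPoly_spec Φ.H Φ.H_ne_zero).1]
      simp [xiStar]
    | succ j =>
      have h1 := (hessPoly_spec Φ.H Φ.H_ne_zero).2.1 ⟨j, by omega⟩
      rw [Fin.sum_univ_castSucc] at h1
      have h2 := congrArg (fun q => aeval Φ.A q Φ.xiStar) h1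
      have ih' : ∀ (i : ℕ) (hi : i < j + 1),
          aeval Φ.A (hessPoly Φ.H i) Φ.xiStar = Φ.Estar ⟨i, by omega⟩ Φ.xi := fun i hi =>
        ih i hi (by omega)
      simp only [map_mul, aeval_X, Module.End.mul_apply, map_add, map_sum, LinearMap.add_apply,
        LinearMap.sum_apply, aeval_C, Module.algebraMap_end_apply, Fin.val_castSucc,
        Fin.val_last] at h2
      rw [ih' j (by omega), A_Estar_xi,
        Finset.sum_congr rfl fun (i : Fin (j + 1)) _ => by rw [ih' i i.2]] at h2
      -- The Hessenberg shape truncates the full column to its first j + 2 entries, matching the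
      -- recurrence.
      have h3 : ∑ i, Φ.H i ⟨j, by omega⟩ • Φ.Estar i Φ.xi =
          ∑ i : Fin (j + 2), Φ.H ⟨i, by omega⟩ ⟨j, by omega⟩ • Φ.Estar ⟨i, by omega⟩ Φ.xi := by
        refine (Fintype.sum_of_injective (Fin.castLE (by omega : j + 2 ≤ d + 1))
          (Fin.castLE_injective _) _ _ (fun i hi => ?_) fun i => rfl).symm
        rw [Φ.H_eq_zero, zero_smul]
        by_contra hcon
        simp only at hcon
        exact hi ⟨⟨i, by omega⟩, rfl⟩
      rw [h3, Fin.sum_univ_castSucc] at h2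
      exact (smul_right_injective V (Φ.H_ne_zero ⟨j, by omega⟩) (add_left_cancel h2)).symm

theorem P_eq_eval_s (Φ : THSystem K V d) (i j : Fin (d + 1)) :
    Φ.P i j = (Φ.s j).eval (Φ.theta i) := by
  have h := Φ.E_Estar_xi i j
  rw [← Φ.aeval_s_xiStar j j.2, E_aeval_apply] at h
  exact (smul_left_injective K (Φ.E_xiStar_ne_zero i) h).symm

/-! ### The last row of `P` -/

/-- Each application of A* climbs at most one step in the flag of the E_k V, and ξ starts in E_0 V.
-/
theorem E_aeval_Astar_xi (Φ : THSystem K V d) (q : K[X]) (l : Fin (d + 1))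
    (hl : q.natDegree < l) : Φ.E l (aeval Φ.Astar q Φ.xi) = 0 := by
  have hpow : ∀ (n : ℕ) (l : Fin (d + 1)), n < l → Φ.E l ((Φ.Astar ^ n) Φ.xi) = 0 := by
    intro n
    induction n with
    | zero =>
      intro l hl
      rw [pow_zero, Module.End.one_apply, Φ.E_of_mem_range Φ.xi_mem,
        if_neg (by rintro rfl; simp at hl)]
    | succ n ih =>
      intro l hl
      simpa [pow_succ'] using (Φ.raise n 0 ih).1 l hl
  rw [aeval_eq_sum_range, LinearMap.sum_apply, map_sum]
  refine Finset.sum_eq_zero fun n hn => ?_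
  rw [LinearMap.smul_apply, map_smul, hpow n l (by rw [Finset.mem_range] at hn; omega), smul_zero]

theorem aeval_Astar_prod_erase (Φ : THSystem K V d) (j : Fin (d + 1)) (v : V) :
    aeval Φ.Astar (∏ h ∈ Finset.univ.erase j, (X - C (Φ.thetaStar h))) v =
      Φ.nodeProd j • Φ.Estar j v := by
  rw [← sub_eq_zero]
  refine Φ.star.eq_zero_of_E fun k => ?_
  rw [map_sub, map_smul, sub_eq_zero]
  refine (Φ.star.E_aeval_apply k _ v).trans ?_
  change _ = Φ.nodeProd j • Φ.Estar k (Φ.Estar j v)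
  rw [Estar_Estar_apply, eval_prod]
  by_cases hk : k = j
  · subst hk
    simp [nodeProd, thetaStar, star]
  · rw [if_neg hk, Finset.prod_eq_zero (Finset.mem_erase.2 ⟨hk, Finset.mem_univ k⟩), zero_smul,
      smul_zero]
    simp [thetaStar]

/-- Up to `nodeProd`, E*_j ξ is q_j(A*) ξ with q_j monic of degree d. As E_d kills what comes from
lower degree, E_d q_j(A*) ξ does not depend on j; comparison with j = 0, where E*_0 ξ = ξ*, gives
the ratio ℓ_j. -/
theorem P_last (Φ : THSystem K V d) (j : Fin (d + 1)) : Φ.P (Fin.last d) j = Φ.ell j := by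
  let q : Fin (d + 1) → K[X] := fun j => ∏ h ∈ Finset.univ.erase j, (X - C (Φ.thetaStar h))
  have hmonic : ∀ j, (q j).Monic := fun j => monic_prod_of_monic _ _ fun h _ => monic_X_sub_C _
  have hdeg : ∀ j, (q j).natDegree = d := fun j => by
    simp [q, natDegree_prod_of_monic _ _ fun h _ => monic_X_sub_C (Φ.thetaStar h)]
  have h1 : Φ.E (Fin.last d) (aeval Φ.Astar (q j - q 0) Φ.xi) = 0 := by
    by_cases hq : q j - q 0 = 0
    · rw [hq]
      simp
    · refine Φ.E_aeval_Astar_xi _ _ ?_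
      refine lt_of_lt_of_eq ?_ (hdeg j)
      refine natDegree_lt_natDegree hq (degree_sub_lt_left ?_ (hmonic j).ne_zero ?_)
      · rw [degree_eq_natDegree (hmonic j).ne_zero, degree_eq_natDegree (hmonic 0).ne_zero, hdeg,
          hdeg]
      · rw [hmonic j, hmonic 0]
  rw [map_sub, LinearMap.sub_apply, map_sub, sub_eq_zero, aeval_Astar_prod_erase,
    aeval_Astar_prod_erase, map_smul, map_smul, E_Estar_xi, smul_smul] at h1
  have h2 := smul_left_injective K (Φ.E_xiStar_ne_zero (Fin.last d)) h1
  rw [ell_eq, eq_div_iff (Φ.nodeProd_ne_zero j), mul_comm]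
  exact h2

/-! ### Duality -/

/-- The covector `Ψ.xi` on E_a E*_b ξ is computed from the `Ψ` side (`key`) and from the Φ side
(`key'`). Column b = 0 and row a = d relate the remaining unknowns to a single nonzero scalar, which
cancels. -/
theorem P_div_ell_eq (Φ : THSystem K V d) (i j : Fin (d + 1)) :
    Φ.P i j / Φ.ell j = Φ.tilde.star.P j.rev i.rev / Φ.tilde.star.ell i.rev := by
  set Ψ := Φ.tilde.star
  have hE : ∀ (k : Fin (d + 1)) (f : Module.Dual K V) (v : V),
      Ψ.E k f v = f (Φ.Estar k.rev v) := fun _ _ _ => rfl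
  have hEs : ∀ (k : Fin (d + 1)) (f : Module.Dual K V) (v : V),
      Ψ.Estar k f v = f (Φ.E k.rev v) := fun _ _ _ => rfl
  have hxs : ∀ v, Ψ.xiStar v = Ψ.xi (Φ.E (Fin.last d) v) := fun v => by
    rw [xiStar, hEs, Fin.rev_zero]
  have key : ∀ a b, Ψ.xi (Φ.E a (Φ.Estar b Φ.xi)) =
      Ψ.P b.rev a.rev * Ψ.xi (Φ.E (Fin.last d) (Φ.Estar b Φ.xi)) := fun a b => by
    have h := LinearMap.congr_fun (Ψ.E_Estar_xi b.rev a.rev) Φ.xi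
    rw [hE, hEs, LinearMap.smul_apply, hE, hxs, Fin.rev_rev, Fin.rev_rev] at h
    exact h
  have key' : ∀ a b, Ψ.xi (Φ.E a (Φ.Estar b Φ.xi)) = Φ.P a b * Ψ.xi (Φ.E a Φ.xiStar) :=
    fun a b => by rw [E_Estar_xi, map_smul, smul_eq_mul]
  -- E*_0 V is spanned by ξ*, so vanishing here would make the last component of `Ψ.xiStar` zero.
  have hne : Ψ.xi (Φ.E (Fin.last d) Φ.xiStar) ≠ 0 := by
    intro h0
    refine Ψ.E_xiStar_ne_zero (Fin.last d) (LinearMap.ext fun v => ?_)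
    obtain ⟨c, hc⟩ := Φ.star.theta_spec.exists_smul Φ.star.multFree 0
      (Φ.Estar_ne_zero Φ.xi_mem Φ.xi_ne_zero 0) v
    change Φ.Estar 0 v = c • Φ.xiStar at hc
    rw [hE, hxs, Fin.rev_last, hc, map_smul, map_smul, h0, smul_zero, LinearMap.zero_apply]
  have h1 := key i j
  have h2 := key i 0
  rw [key', key', P_last] at h1
  rw [Fin.rev_zero, P_last] at h2
  change Ψ.xi (Φ.E i Φ.xiStar) = Ψ.ell i.rev * Ψ.xi (Φ.E (Fin.last d) Φ.xiStar) at h2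
  rw [h2] at h1
  rw [div_eq_div_iff (Φ.ell_ne_zero j) (Ψ.ell_ne_zero i.rev)]
  refine mul_right_cancel₀ hne ?_
  linear_combination h1

/-! ### The split sequence -/

theorem Astar_splitVec (Φ : THSystem K V d) (i : Fin d) :
    (Φ.Astar - Φ.thetaStar i.succ • 1) (Φ.splitVec i.succ) = Φ.splitVec i.castSucc := by
  have hI : Finset.Ioi i.castSucc = insert i.succ (Finset.Ioi i.succ) := by
    ext k
    simp only [Finset.mem_Ioi, Finset.mem_insert, Fin.lt_def, Fin.ext_iff, Fin.val_succ,
      Fin.val_castSucc]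
    omega
  rw [splitVec, splitVec, hI, Finset.prod_insert (by simp), map_mul, Module.End.mul_apply]
  simp [Algebra.algebraMap_eq_smul_one]

/-- The split vectors are scaled so that A* lowers them with coefficient one; the eigenvalue on
U_{i+1} then appears whole in the raising action of A. -/
theorem A_splitVec (Φ : THSystem K V d) (i : Fin d) :
    (Φ.A - Φ.theta i.castSucc.rev • 1) (Φ.splitVec i.castSucc) =
      Φ.phi i • Φ.splitVec i.succ := by
  have h := (Φ.existsUnique_phi i).choose_spec.1 _ (Φ.splitVec_mem i.succ)
  rwa [Astar_splitVec] at h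

theorem phi_ne_zero (Φ : THSystem K V d) (i : Fin d) : Φ.phi i ≠ 0 := by
  intro h0
  have h := Φ.A_splitVec i
  rw [h0, zero_smul] at h
  -- The top component of a split vector in the E*-flag is nonzero, and A raises it to a nonzero
  -- component one step higher.
  refine (Φ.star.raise i (Φ.theta i.castSucc.rev) (v := Φ.splitVec i.castSucc)
    (fun l hl => ((Φ.mem_splitSpace_iff _ _).1 (Φ.splitVec_mem i.castSucc)).1 l
      (Fin.lt_def.2 hl))).2 i.succ i.castSucc (by simp) (by simp)
      (Φ.Estar_splitVec_ne_zero i.castSucc) ?_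
  have h' : Φ.star.Astar (Φ.splitVec i.castSucc) -
      Φ.theta i.castSucc.rev • Φ.splitVec i.castSucc = 0 := by
    rw [← h]
    simp [star]
  rw [h', map_zero]

/-- The product `φ_1 ⋯ φ_h`. -/
noncomputable def phiProd (Φ : THSystem K V d) (h : ℕ) : K :=
  ∏ i ∈ Finset.univ.filter (fun i : Fin d => (i : ℕ) < h), Φ.phi i

theorem phiProd_ne_zero (Φ : THSystem K V d) (h : ℕ) : Φ.phiProd h ≠ 0 :=
  Finset.prod_ne_zero_iff.2 fun i _ => Φ.phi_ne_zero i

/-- Under E_i the operator A becomes the scalar θ_i, so each raising step contributes one factor of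
η_h and one φ. -/
theorem E_splitVec (Φ : THSystem K V d) (i h : Fin (d + 1)) :
    Φ.phiProd h • Φ.E i (Φ.splitVec h) =
      (Φ.eta h).eval (Φ.theta i) • Φ.E i (Φ.splitVec 0) := by
  induction h using Fin.induction with
  | zero => simp [phiProd, eta]
  | succ h ih =>
    have h1 : Φ.phiProd h.succ = Φ.phi h * Φ.phiProd h.castSucc := by
      rw [phiProd, phiProd, ← Finset.prod_insert (by simp)]
      refine Finset.prod_congr ?_ fun _ _ => rfl
      ext k
      simp only [Finset.mem_filter, Finset.mem_univ, true_and, Finset.mem_insert, Fin.ext_iff,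
        Fin.val_succ, Fin.val_castSucc]
      omega
    have h2 : Φ.eta h.succ = (X - C (Φ.theta h.castSucc.rev)) * Φ.eta h.castSucc := by
      rw [eta, eta, ← Finset.prod_insert
        (f := fun k : Fin (d + 1) => X - C (Φ.theta k.rev)) (by simp)]
      refine Finset.prod_congr ?_ fun _ _ => rfl
      ext k
      simp only [Finset.mem_filter, Finset.mem_univ, true_and, Finset.mem_insert, Fin.ext_iff,
        Fin.val_succ, Fin.val_castSucc]
      omega
    have h3 := congrArg (Φ.E i) (Φ.A_splitVec h)
    rw [map_smul, LinearMap.sub_apply, map_sub, E_A_apply, LinearMap.smul_apply, map_smul,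
      Module.End.one_apply, ← sub_smul] at h3
    rw [h1, h2, mul_comm, ← smul_smul, ← h3, smul_comm, ih, smul_smul]
    simp

theorem splitVec_zero (Φ : THSystem K V d) : Φ.splitVec 0 = Φ.nodeProd 0 • Φ.xiStar := by
  rw [xiStar, ← aeval_Astar_prod_erase, splitVec]
  congr 3
  ext h
  simp

/-- The difference quotient of `∏_k (x - a_k)`, split along the nodes. -/
theorem sub_mul_sum_prod {n : ℕ} (a : Fin n → K) (x y : K) :
    (x - y) * ∑ h, (∏ k ∈ Finset.Iio h, (y - a k)) * ∏ k ∈ Finset.Ioi h, (x - a k) =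
      ∏ k, (x - a k) - ∏ k, (y - a k) := by
  -- Write y - a_k as (x - a_k) + (y - x) and expand by the first index where the second summand is
  -- split off.
  have h := Finset.prod_add_ordered Finset.univ (fun k => x - a k) fun _ => y - x
  simp only [sub_add_sub_cancel', Finset.filter_lt_eq_Ioi, Finset.filter_gt_eq_Iio] at h
  simp only [mul_assoc, ← Finset.mul_sum] at h
  linear_combination h

/-- Under E*_l the right side acquires the coefficient Σ_h ∏_{k<h}(θ*_j - θ*_k) ∏_{k>h}(θ*_l -
θ*_k). For l ≠ j this is a difference quotient of ∏_k(x - θ*_k) between two of its roots, hence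
zero; for l = j only h = l survives. -/
theorem nodeProd_smul_Estar_xi (Φ : THSystem K V d) (j : Fin (d + 1)) :
    Φ.nodeProd j • Φ.Estar j Φ.xi =
      ∑ h : Fin (d + 1), (Φ.star.tau h).eval (Φ.thetaStar j) • Φ.splitVec h := by
  rw [← sub_eq_zero]
  refine Φ.star.eq_zero_of_E fun l => ?_
  change Φ.Estar l _ = 0
  rw [map_sub, map_sum, map_smul, sub_eq_zero,
    Finset.sum_congr rfl fun h _ => by
      rw [map_smul, Estar_splitVec, smul_smul, Φ.star.eval_tau], ← Finset.sum_smul]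
  refine (congrArg _ (Φ.star.E_E_apply l j _)).trans ?_
  by_cases hlj : l = j
  · subst hlj
    rw [if_pos rfl, Finset.sum_eq_single l]
    · exact congrArg (· • _) (prod_Iio_mul_prod_Ioi l _).symm
    · intro h _ hh
      rcases lt_or_gt_of_ne hh with hh | hh
      · rw [Finset.prod_eq_zero (Finset.mem_Ioi.2 hh) (sub_self _), mul_zero]
      · rw [Finset.prod_eq_zero (Finset.mem_Iio.2 hh) (sub_self _), zero_mul]
    · simp
  · have h1 := sub_mul_sum_prod Φ.thetaStar (Φ.thetaStar l) (Φ.thetaStar j)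
    rw [Finset.prod_eq_zero (Finset.mem_univ l) (sub_self _),
      Finset.prod_eq_zero (Finset.mem_univ j) (sub_self _), sub_zero] at h1
    have h2 := (mul_eq_zero.1 h1).resolve_left (Φ.star.theta_sub_ne_zero hlj)
    rw [if_neg hlj, smul_zero]
    exact (smul_eq_zero_of_left h2 _).symm

theorem normP_apply (Φ : THSystem K V d) (i j : Fin (d + 1)) :
    Φ.normP i j = ∑ h : Fin (d + 1), (Φ.phiProd h)⁻¹ *
      ((Φ.eta h).eval (Φ.theta i) * (Φ.star.tau h).eval (Φ.thetaStar j)) := by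
  have haeval : ∀ (q : K[X]) (k : Fin 2) (x : Fin 2 → K),
      MvPolynomial.eval x (aeval (MvPolynomial.X k) q) = q.eval (x k) := fun q k x => by
    rw [← MvPolynomial.coe_aeval_eq_eval, RingHom.coe_coe, ← aeval_algHom_apply]
    simp [aeval_def, eval₂_eq_eval_map]
  simp only [normP, Matrix.of_apply, twoVarPoly, map_sum, map_mul, MvPolynomial.eval_C, haeval]
  rfl

theorem normP_eq (Φ : THSystem K V d) (i j : Fin (d + 1)) :
    Φ.normP i j = Φ.P i j / Φ.ell j := by
  have h1 := congrArg (Φ.E i) (Φ.nodeProd_smul_Estar_xi j)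
  have h2 : ∀ h : Fin (d + 1), Φ.E i (Φ.splitVec h) =
      ((Φ.phiProd h)⁻¹ * (Φ.eta h).eval (Φ.theta i) * Φ.nodeProd 0) • Φ.E i Φ.xiStar := by
    intro h
    rw [mul_assoc, ← smul_smul, ← smul_smul, ← map_smul (Φ.E i) (Φ.nodeProd 0), ← splitVec_zero,
      ← E_splitVec, smul_smul, inv_mul_cancel₀ (Φ.phiProd_ne_zero h), one_smul]
  rw [map_smul, map_sum, E_Estar_xi, smul_smul,
    Finset.sum_congr rfl fun h _ => by rw [map_smul, h2 h, smul_smul], ← Finset.sum_smul] at h1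
  have h3 := smul_left_injective K (Φ.E_xiStar_ne_zero i) h1
  rw [eq_div_iff (Φ.ell_ne_zero j), ell_eq, mul_div_assoc', div_eq_iff (Φ.nodeProd_ne_zero j),
    mul_comm (Φ.P i j), h3, normP_apply, Finset.sum_mul]
  exact Finset.sum_congr rfl fun h _ => by ring

/-! ### The product of `P` and `P*` -/

/-- E_0 E*_0 maps into the line of E_0 ξ*, the first vector of the basis {E_i ξ*}, so its trace is
its one possibly nonzero diagonal entry, the eigenvalue on that vector. -/
theorem E_zero_xiStar (Φ : THSystem K V d) :
    Φ.E 0 Φ.xiStar = LinearMap.trace K V (Φ.E 0 * Φ.Estar 0) • Φ.xi := by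
  have hx : Φ.E 0 Φ.xi = Φ.xi := by simpa using Φ.E_of_mem_range Φ.xi_mem 0
  obtain ⟨c, hc⟩ := Φ.theta_spec.exists_smul Φ.multFree 0 (v := Φ.xi)
    (by rw [hx]; exact Φ.xi_ne_zero) Φ.xiStar
  rw [hx] at hc
  let b := Φ.star.standardBasis Φ.xiStar (Φ.Estar_mem_range Φ.xi)
    (Φ.Estar_ne_zero Φ.xi_mem Φ.xi_ne_zero 0)
  have hb : ∀ i, b i = Φ.E i Φ.xiStar := fun i => Φ.star.standardBasis_apply _ _ _ i
  have h1 : (Φ.E 0 * Φ.Estar 0) (b 0) = c • b 0 := by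
    rw [hb, hc, map_smul, Module.End.mul_apply]
    exact congrArg _ hc
  have h2 : ∀ v, ∃ a : K, (Φ.E 0 * Φ.Estar 0) v = a • b 0 := fun v => by
    rw [hb]
    exact Φ.theta_spec.exists_smul Φ.multFree 0 (Φ.E_xiStar_ne_zero 0) _
  rw [hc, LinearMap.trace_eq_matrix_trace K b, Matrix.trace, Finset.sum_eq_single 0]
  · rw [Matrix.diag_apply, LinearMap.toMatrix_apply, h1]
    simp
  · intro i _ hi
    obtain ⟨a, ha⟩ := h2 (b i)
    rw [Matrix.diag_apply, LinearMap.toMatrix_apply, ha]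
    simp [hi.symm]
  · simp

theorem trace_ne_zero (Φ : THSystem K V d) : LinearMap.trace K V (Φ.E 0 * Φ.Estar 0) ≠ 0 := by
  intro h0
  refine Φ.E_xiStar_ne_zero 0 ?_
  rw [E_zero_xiStar, h0, zero_smul]

/-- Started from ξ*, the second change of basis lands on E*_i E_0 ξ* = c E*_i ξ, with c the trace;
expanding back through P returns to {E_i ξ*}, so c PP* = I. -/
theorem P_mul_star_P (Φ : THSystem K V d) : Φ.P * Φ.star.P = Φ.nu • 1 := by
  set c := LinearMap.trace K V (Φ.E 0 * Φ.Estar 0)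
  have hx := Φ.Estar_ne_zero Φ.xi_mem Φ.xi_ne_zero 0
  have hmem : Φ.xiStar ∈ LinearMap.range (Φ.star.E 0) := Φ.Estar_mem_range Φ.xi
  let b := Φ.star.standardBasis Φ.xiStar hmem hx
  have hb : ∀ i, b i = Φ.E i Φ.xiStar := fun i => Φ.star.standardBasis_apply _ _ _ i
  have h1 : ∀ j, b j = c • ∑ i, Φ.star.P i j • Φ.Estar i Φ.xi := fun j => by
    have h := (Φ.star.star.standardBasis (Φ.star.Estar 0 Φ.xiStar)
      (Φ.star.Estar_mem_range Φ.xiStar) (Φ.star.Estar_ne_zero hmem hx 0)).sum_toMatrix_smul_self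
        b j
    -- `Φ.star.P` is defined from its own chosen vector; independence of that choice allows ξ*
    -- instead.
    rw [← h, Finset.smul_sum, Φ.star.P_eq_transMat Φ.xiStar hmem hx]
    refine Finset.sum_congr rfl fun i _ => ?_
    rw [standardBasis_apply]
    change _ • Φ.Estar i (Φ.E 0 Φ.xiStar) = _
    rw [E_zero_xiStar, map_smul, smul_comm]
    rfl
  have h2 : ∀ j, b j = ∑ k, (c * (Φ.P * Φ.star.P) k j) • b k := fun j => by
    rw [h1, Finset.smul_sum]
    simp only [Estar_xi_eq_sum, ← hb, Finset.smul_sum, Matrix.mul_apply, Finset.mul_sum,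
      Finset.sum_smul, smul_smul]
    rw [Finset.sum_comm]
    exact Finset.sum_congr rfl fun k _ => Finset.sum_congr rfl fun i _ => by
      rw [mul_comm (Φ.P k i)]
  ext i j
  have h3 : (if i = j then 1 else 0) = c * (Φ.P * Φ.star.P) i j := by
    have h := congrFun (b.repr_sum_self fun k => c * (Φ.P * Φ.star.P) k j) i
    rw [← h2, b.repr_self, Finsupp.single_apply] at h
    simpa only [eq_comm] using h
  rw [Matrix.smul_apply, Matrix.one_apply, h3, nu, smul_eq_mul,
    inv_mul_cancel_left₀ Φ.trace_ne_zero]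

theorem star_P_mul_P (Φ : THSystem K V d) : Φ.star.P * Φ.P = Φ.nu • 1 := by
  have hnu : Φ.nu ≠ 0 := inv_ne_zero Φ.trace_ne_zero
  have h : Φ.P * (Φ.nu⁻¹ • Φ.star.P) = 1 := by
    rw [Matrix.mul_smul, P_mul_star_P, smul_smul, inv_mul_cancel₀ hnu, one_smul]
  have h' := mul_eq_one_comm.1 h
  rw [Matrix.smul_mul, inv_smul_eq_iff₀ hnu] at h'
  exact h'

/-! ### Evaluating the polynomials at the eigenvalues -/

theorem eval_t_theta (Φ : THSystem K V d) (i j : Fin (d + 1)) :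
    (Φ.t j).eval (Φ.theta i) = Φ.P i j / Φ.ell j := by
  rw [eval_t, P_eq_eval_s]

theorem eval_tilde_star_t (Φ : THSystem K V d) (i j : Fin (d + 1)) :
    (Φ.tilde.star.t i.rev).eval (Φ.thetaStar j) = Φ.P i j / Φ.ell j := by
  rw [P_div_ell_eq, ← eval_t_theta, theta_tilde_star, Fin.rev_rev]

/-- This is the preceding duality for Φ*, since `Φ.star.tilde.star` unfolds to `Φ.tilde`. -/
theorem eval_tilde_t (Φ : THSystem K V d) (j n : Fin (d + 1)) :
    (Φ.tilde.t j).eval (Φ.theta n) = Φ.star.P j.rev n / Φ.star.ell n := by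
  have h := Φ.star.eval_tilde_star_t j.rev n
  rw [Fin.rev_rev] at h
  exact h

end THSystem

theorem corollary17p7 {K V : Type*} [Field K] [AddCommGroup V] [Module K V] {d : ℕ}
    (Φ : THSystem K V d) :
    (∀ i j : Fin (d + 1),
      Φ.P i j = Φ.ell j * (Φ.t j).eval (Φ.theta i) ∧
      Φ.P i j = Φ.ell j * (Φ.tilde.star.t i.rev).eval (Φ.thetaStar j) ∧
      Φ.P i j = (Φ.s j).eval (Φ.theta i) ∧
      Φ.P i j = Φ.ell j * (Φ.tilde.star.s i.rev).eval (Φ.thetaStar j) / Φ.tilde.star.ell i.rev) ∧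
    (∀ i j : Fin (d + 1),
      Φ.normP i j = (Φ.t j).eval (Φ.theta i) ∧
      Φ.normP i j = (Φ.tilde.star.t i.rev).eval (Φ.thetaStar j) ∧
      Φ.normP i j = (Φ.s j).eval (Φ.theta i) / Φ.ell j ∧
      Φ.normP i j = (Φ.tilde.star.s i.rev).eval (Φ.thetaStar j) / Φ.tilde.star.ell i.rev) ∧
    (∀ i j : Fin (d + 1),
      ∑ n : Fin (d + 1), (Φ.t i).eval (Φ.theta n) * (Φ.tilde.t j).eval (Φ.theta n) *
        Φ.star.ell n = (if (i : ℕ) + j = d then 1 else 0) * Φ.nu * (Φ.ell i)⁻¹) ∧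
    (∀ m n : Fin (d + 1),
      ∑ i : Fin (d + 1), (Φ.t i).eval (Φ.theta m) * (Φ.tilde.t i.rev).eval (Φ.theta n) *
        Φ.ell i = (if m = n then 1 else 0) * Φ.nu * (Φ.star.ell m)⁻¹) := by
  refine ⟨fun i j => ?_, fun i j => ?_, fun i j => ?_, fun m n => ?_⟩
  · have hs := Φ.eval_tilde_star_t i j
    have hl := Φ.ell_ne_zero j
    refine ⟨?_, ?_, Φ.P_eq_eval_s i j, ?_⟩
    · rw [Φ.eval_t_theta, mul_div_cancel₀ _ hl]
    · rw [hs, mul_div_cancel₀ _ hl]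
    · rw [mul_div_assoc, ← THSystem.eval_t, hs, mul_div_cancel₀ _ hl]
  · have hs := Φ.eval_tilde_star_t i j
    refine ⟨?_, ?_, ?_, ?_⟩
    · rw [Φ.normP_eq, Φ.eval_t_theta]
    · rw [Φ.normP_eq, hs]
    · rw [Φ.normP_eq, Φ.P_eq_eval_s]
    · rw [← THSystem.eval_t, hs, Φ.normP_eq]
  -- The sum is entry (d - j, i) of P*P divided by ℓ_i: the weight ℓ*_n cancels the denominator of
  -- the dual polynomial.
  · have h := congrFun (congrFun Φ.star_P_mul_P j.rev) i
    rw [Matrix.mul_apply, Matrix.smul_apply, Matrix.one_apply, smul_eq_mul] at h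
    have hij : (j.rev = i) ↔ ((i : ℕ) + j = d) := by
      rw [Fin.ext_iff, Fin.val_rev]
      omega
    simp only [hij] at h
    rw [mul_comm (ite _ _ _), ← h, Finset.sum_mul]
    refine Finset.sum_congr rfl fun n _ => ?_
    rw [Φ.eval_t_theta, Φ.eval_tilde_t]
    have := Φ.star.ell_ne_zero n
    field_simp
  · have h := congrFun (congrFun Φ.P_mul_star_P m) n
    rw [Matrix.mul_apply, Matrix.smul_apply, Matrix.one_apply, smul_eq_mul] at h
    -- The computation produces ℓ*_n in the denominator; the delta makes it interchangeable with
    -- ℓ*_m.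
    have hmn : (if m = n then 1 else 0) * Φ.nu * (Φ.star.ell m)⁻¹ =
        (Φ.nu * if m = n then 1 else 0) * (Φ.star.ell n)⁻¹ := by
      by_cases hmn : m = n <;> simp [hmn]
    rw [hmn, ← h, Finset.sum_mul]
    refine Finset.sum_congr rfl fun i _ => ?_
    rw [Φ.eval_t_theta, Φ.eval_tilde_t, Fin.rev_rev]
    have := Φ.ell_ne_zero i
    field_simp
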